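/- Let $\mathfrak A$ be a complex unital Banach algebra (for instance the bounded operators on a complex Hilbert space, or complex matrices with the operator norm). For $A,B\in\mathfrak A$, $0<\alpha\le 1$ and $\lambda\in\mathbb C$ put $H=A+\alpha B$, $\mathrm{ad}_A(X)=AX-XA$, and let $$S_2(\lambda)=e^{\lambda A/2}\,e^{\alpha\lambda B}\,e^{\lambda A/2}$$ be the second-order product formula (Strang splitting). For an integer $k\ge 1$ define the symplectic corrector and the corrected product formula $$C(k)=\alpha\sum_{j=1}^{k}\frac{B_{2j}(1/2)}{(2j)!}\,\lambda^{2j}\,\mathrm{ad}_A^{2j-1}(B),\qquad S_2^c(\lambda)=e^{C(k)}S_2(\lambda)e^{-C(k)},$$ where $B_n(x)$ are the Bernoulli polynomials, $\frac{te^{tx}}{e^t-1}=\sum_{n\ge0}B_n(x)\frac{t^n}{n!}$. Then for every $k\ge1$ and every $M\ge 0$ there is a constant $K$ (depending only on $\mathfrak A$, $k$ and $M$) such that for all $A,B\in\mathfrak A$ with $\|A\|,\|B\|\le M$, all $0<\alpha\le1$ and all $\lambda\in\mathbb C$ with $|\lambda|<1$, $$\bigl\|e^{\lambda H}-S_2^c(\lambda)\bigr\|\le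 K\left(\alpha^2|\lambda|^3+\alpha|\lambda|^{2k+3}\right).$$ -/

import Mathlib

open scoped Nat

noncomputable section

namespace CorrectedPF

variable {𝔸 : Type*} [NormedRing 𝔸] [NormedAlgebra ℂ 𝔸]

/-- The commutator map `ad_A(X) = [A, X] = A X - X A`. -/
def ad (A X : 𝔸) : 𝔸 := A * X - X * A

/-- The Hamiltonian `H = A + α B` of the perturbed system. -/
def hamiltonian (A B : 𝔸) (α : ℝ) : 𝔸 := A + (α : ℂ) • B

/-- The second-order product formula (Strang splitting)
`S₂(z) = exp (z A / 2) exp (α z B) exp (z A / 2)`. -/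
def S₂ (A B : 𝔸) (α : ℝ) (z : ℂ) : 𝔸 :=
  NormedSpace.exp ((z / 2) • A) * NormedSpace.exp (((α : ℂ) * z) • B) *
    NormedSpace.exp ((z / 2) • A)

/-- The symplectic corrector
`C(k) = α ∑_{j=1}^k B_{2j}(1/2) / (2j)! z^{2j} ad_A^{2j-1}(B)`, where `B_n(x)` are the Bernoulli
polynomials. -/
def corrector (A B : 𝔸) (α : ℝ) (k : ℕ) (z : ℂ) : 𝔸 :=
  (α : ℂ) • ∑ j ∈ Finset.Icc 1 k,
    ((((Polynomial.bernoulli (2 * j)).eval (1 / 2 : ℚ) : ℚ) : ℂ) / ((2 * j)! : ℂ) * z ^ (2 * j)) •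
      (ad A)^[2 * j - 1] B

/-- The corrected product formula `exp (C(k)) S₂(z) exp (-C(k))`. -/
def correctedS₂ (A B : 𝔸) (α : ℝ) (k : ℕ) (z : ℂ) : 𝔸 :=
  NormedSpace.exp (corrector A B α k z) * S₂ A B α z * NormedSpace.exp (-corrector A B α k z)

end CorrectedPF

end

/-! Put X = λA, Y = αλB, t = |λ|, and let p be the corrector polynomial, so that C = p(ad_X)Y.
Expand both sides in powers of Y. With φ(x) = (e^x - 1)/x, Duhamel's formula gives e^{X+Y} = e^X +
(φ(ad_X)Y)e^X + Y²/2 + O(α²t³) (`norm_exp_add_sub_le`). Since C = O(αt²), the product formula is e^X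
+ e^{X/2}Ye^{X/2} + Y²/2 + [C, e^X] + O(α²t³) (`isBigO_conj_sub`). The terms e^X and Y²/2 cancel.
Left and right multiplication by X commute and differ by ad_X, so the remaining linear terms are
r(ad_X) applied to Y, times e^X on the right, with r = φ - e^{x/2} - (1 - e^x)p = φ(1 + xp) -
e^{x/2} (`firstOrder_eq`). The Bernoulli generating function b at 1/2 satisfies φb = e^{x/2}, and 1
+ xp agrees with b below degree 2k + 2. Hence r = O(x^{2k+2}), and applying it to Y = O(αt) leaves
O(αt^{2k+3}). -/

namespace CorrectedPF

open Asymptotics Filter Finset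

/-! ### Bernoulli identity for formal power series -/

section PowerSeriesIdentity

open PowerSeries

/-- The truncated corrector `∑_{j=1}^k B_{2j}(1/2) / (2j)! X^{2j-1}` as a polynomial in `ad_A`. -/
noncomputable def correctorPoly (k : ℕ) : Polynomial ℂ :=
  ∑ j ∈ Icc 1 k, Polynomial.C ((((Polynomial.bernoulli (2 * j)).eval (1 / 2 : ℚ) : ℚ) : ℂ) /
    ((2 * j)! : ℂ)) * Polynomial.X ^ (2 * j - 1)

/-- The generating series `∑ B_n(1/2) / n! X^n`. -/
noncomputable def midpointBernoulliSeries : ℂ⟦X⟧ :=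
  mk fun n => (((Polynomial.bernoulli n).eval (1 / 2 : ℚ) : ℚ) : ℂ) / (n ! : ℂ)

theorem midpointBernoulliSeries_mul_exp_sub_one :
    midpointBernoulliSeries * (PowerSeries.exp ℂ - 1) =
      X * rescale (1 / 2 : ℂ) (PowerSeries.exp ℂ) := by
  rw [← Polynomial.bernoulli_generating_function]
  congr 2
  ext n
  have h : (1 / 2 : ℂ) = algebraMap ℚ ℂ (1 / 2) := by simp
  rw [midpointBernoulliSeries, coeff_mk, coeff_mk, h, Polynomial.aeval_algebraMap_apply, Polynomial.coe_aeval_eq_eval, Polynomial.eval_smul]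
  simp [div_eq_inv_mul]

/-- The point 1/2 is fixed by the reflection B_n(1 - x) = (-1)^n B_n(x). -/
theorem bernoulli_eval_half_of_odd {n : ℕ} (hn : Odd n) :
    (Polynomial.bernoulli n).eval (1 / 2 : ℚ) = 0 := by
  have h := Polynomial.bernoulli_eval_one_sub n (1 / 2)
  rw [hn.neg_one_pow] at h
  norm_num at h ⊢
  linarith

/-- The series `∑ X^n / (n+1)!` of `(e^X - 1) / X`. -/
noncomputable def phiSeries : ℂ⟦X⟧ := mk fun n => (((n + 1)! : ℂ))⁻¹

theorem X_mul_phiSeries : X * phiSeries = PowerSeries.exp ℂ - 1 := by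
  ext n
  cases n with
  | zero => simp
  | succ n => simp [phiSeries, coeff_succ_X_mul, PowerSeries.coeff_one]

/-- Odd coefficients of the Bernoulli series vanish, including the one in degree 2k + 1, so
agreement persists up to degree 2k + 2. -/
theorem coeff_X_mul_correctorPoly (k n : ℕ) (hn : n < 2 * k + 2) :
    coeff n (1 + X * (correctorPoly k : ℂ⟦X⟧) - midpointBernoulliSeries) = 0 := by
  cases n with
  | zero => simp [midpointBernoulliSeries]
  | succ n =>
    simp only [map_sub, map_add, PowerSeries.coeff_one, coeff_succ_X_mul,
      Polynomial.coeff_coe, correctorPoly, Polynomial.finsetSum_coeff, Polynomial.coeff_C_mul,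
      Polynomial.coeff_X_pow, midpointBernoulliSeries, coeff_mk]
    rw [if_neg (by omega), zero_add, sub_eq_zero]
    rcases Nat.even_or_odd (n + 1) with h | h
    · obtain ⟨m, hm⟩ := h
      rw [Finset.sum_eq_single m]
      · rw [if_pos (by omega), mul_one, show n + 1 = 2 * m by omega]
      · intro j hj hjm
        rw [Finset.mem_Icc] at hj
        rw [if_neg (by omega), mul_zero]
      · intro h
        rw [Finset.mem_Icc] at h
        omega
    · rw [bernoulli_eval_half_of_odd h]
      simp only [Rat.cast_zero, zero_div]
      refine Finset.sum_eq_zero fun j hj => ?_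
      rw [Finset.mem_Icc] at hj
      rw [if_neg (by obtain ⟨m, hm⟩ := h; omega), mul_zero]

/-- Since φb = e^{x/2} and e^x - 1 = xφ, the expression equals φ(1 + xp - b). -/
theorem X_pow_dvd_firstOrder (k : ℕ) :
    (X : ℂ⟦X⟧) ^ (2 * k + 2) ∣ phiSeries - rescale (1 / 2 : ℂ) (PowerSeries.exp ℂ) -
      (1 - PowerSeries.exp ℂ) * correctorPoly k := by
  obtain ⟨q, hq⟩ := X_pow_dvd_iff.mpr (coeff_X_mul_correctorPoly k)
  refine ⟨phiSeries * q, ?_⟩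
  have hX : (X : ℂ⟦X⟧) ≠ 0 := X_ne_zero
  apply mul_left_cancel₀ hX
  have h := midpointBernoulliSeries_mul_exp_sub_one
  have h' := X_mul_phiSeries
  linear_combination (1 - X ^ (2 * k + 2) * q) * h' + h + (PowerSeries.exp ℂ - 1) * hq

theorem X_pow_dvd_firstOrder_trunc (k : ℕ) :
    (Polynomial.X : Polynomial ℂ) ^ (2 * k + 2) ∣ trunc (2 * k + 2) phiSeries -
      trunc (2 * k + 2) (rescale (1 / 2 : ℂ) (PowerSeries.exp ℂ)) -
      (1 - trunc (2 * k + 2) (PowerSeries.exp ℂ)) * correctorPoly k := by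
  rw [Polynomial.X_pow_dvd_iff]
  intro d hd
  have h := X_pow_dvd_iff.mp (X_pow_dvd_firstOrder k) d hd
  have e : coeff d (PowerSeries.exp ℂ * (correctorPoly k : ℂ⟦X⟧)) =
      coeff d ((trunc (2 * k + 2) (PowerSeries.exp ℂ) : ℂ⟦X⟧) * (correctorPoly k : ℂ⟦X⟧)) := by
    rw [← coeff_coe_trunc_of_lt hd, ← trunc_trunc_mul, coeff_coe_trunc_of_lt hd]
  rw [sub_mul, map_sub, map_sub, map_sub, e] at h
  rw [← Polynomial.coeff_coe]
  simp only [Polynomial.coe_sub, Polynomial.coe_mul, Polynomial.coe_one, sub_mul, map_sub,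
    coeff_coe_trunc_of_lt hd]
  exact h

end PowerSeriesIdentity

/-! ### Taylor remainders of entire functions in a Banach algebra -/

section EntireSeries

variable {R : Type*} [NormedRing R] [NormedAlgebra ℂ R]

theorem norm_sub_sum_range_le {a : ℕ → ℂ} (ha : ∀ n, ‖a n‖ ≤ (n ! : ℝ)⁻¹) {x s : R}
    (hs : HasSum (fun n => a n • x ^ n) s) {m : ℕ} (hm : m ≠ 0) :
    ‖s - ∑ n ∈ range m, a n • x ^ n‖ ≤ ‖x‖ ^ m * Real.exp ‖x‖ := by
  have h₁ := (hasSum_nat_add_iff' m).mpr hs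
  have h₂ : HasSum (fun n : ℕ => ‖x‖ ^ m * (‖x‖ ^ n / n !)) (‖x‖ ^ m * Real.exp ‖x‖) := by
    rw [Real.exp_eq_exp_ℝ]
    exact (NormedSpace.expSeries_div_hasSum_exp ‖x‖).mul_left _
  refine h₁.norm_le_of_bounded h₂ fun n => ?_
  calc ‖a (n + m) • x ^ (n + m)‖ ≤ ‖a (n + m)‖ * ‖x ^ (n + m)‖ := norm_smul_le _ _
    -- Submultiplicativity needs a positive exponent, hence m ≠ 0: the norm of 1 may exceed 1.
    _ ≤ (n ! : ℝ)⁻¹ * ‖x‖ ^ (n + m) := by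
      refine mul_le_mul ((ha _).trans ?_) (norm_pow_le' _ (by omega)) (norm_nonneg _)
        (by positivity)
      gcongr
      omega
    _ = ‖x‖ ^ m * (‖x‖ ^ n / n !) := by rw [pow_add]; ring

variable {ι : Type*} {l : Filter ι} {x : ι → R} {t : ι → ℝ}

theorem isBigO_sub_sum_range {a : ℕ → ℂ} (ha : ∀ n, ‖a n‖ ≤ (n ! : ℝ)⁻¹) {s : ι → R}
    (hs : ∀ i, HasSum (fun n => a n • x i ^ n) (s i)) (hx : x =O[l] t)
    (ht : t =O[l] fun _ => (1 : ℝ)) {m : ℕ} (hm : m ≠ 0) :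
    (fun i => s i - ∑ n ∈ range m, a n • x i ^ n) =O[l] fun i => t i ^ m := by
  have h₁ : (fun i => ‖x i‖ ^ m) =O[l] fun i => t i ^ m := hx.norm_left.pow m
  have h₂ : (fun i => Real.exp ‖x i‖) =O[l] fun _ => (1 : ℝ) := by
    obtain ⟨c, hc⟩ := (hx.trans ht).bound
    refine IsBigO.of_bound (Real.exp c) ?_
    filter_upwards [hc] with i hi
    simpa using hi
  have h₃ := h₁.mul h₂
  simp only [mul_one] at h₃
  refine IsBigO.trans (IsBigO.of_bound 1 (Eventually.of_forall fun i => ?_)) h₃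
  rw [one_mul, Real.norm_of_nonneg (by positivity)]
  exact norm_sub_sum_range_le ha (hs i) hm

theorem isBigO_aeval (p : Polynomial ℂ) (hx : x =O[l] fun _ => (1 : ℝ)) :
    (fun i => Polynomial.aeval (x i) p) =O[l] fun _ => (1 : ℝ) := by
  simp only [Polynomial.aeval_eq_sum_range]
  refine IsBigO.fun_sum fun n _ => ?_
  exact (show (fun i => x i ^ n) =O[l] fun _ => (1 : ℝ) by
    simpa using hx.pow n).const_smul_left (p.coeff n)

theorem isBigO_aeval_of_X_pow_dvd {p : Polynomial ℂ} {m : ℕ} (hp : Polynomial.X ^ m ∣ p)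
    (hx : x =O[l] t) (ht : t =O[l] fun _ => (1 : ℝ)) :
    (fun i => Polynomial.aeval (x i) p) =O[l] fun i => t i ^ m := by
  obtain ⟨q, rfl⟩ := hp
  simpa using (hx.pow m).mul (isBigO_aeval q (hx.trans ht))

theorem aeval_trunc (f : PowerSeries ℂ) (y : R) (n : ℕ) :
    Polynomial.aeval y (PowerSeries.trunc n f) =
      ∑ i ∈ range n, PowerSeries.coeff i f • y ^ i := by
  rw [Polynomial.aeval_def, PowerSeries.eval₂_trunc_eq_sum_range]
  simp only [Algebra.smul_def]

/-- The entire function `(e^x - 1) / x = ∑ x^n / (n+1)!`. -/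
noncomputable def phi (y : R) : R := ∑' n : ℕ, (((n + 1)! : ℂ))⁻¹ • y ^ n

theorem norm_inv_factorial_succ_le (n : ℕ) : ‖(((n + 1)! : ℂ))⁻¹‖ ≤ (n ! : ℝ)⁻¹ := by
  rw [norm_inv, Complex.norm_natCast]
  gcongr
  omega

theorem summable_norm_phi (y : R) : Summable fun n : ℕ => ‖(((n + 1)! : ℂ))⁻¹ • y ^ n‖ := by
  refine (NormedSpace.norm_expSeries_summable' (𝕂 := ℂ) y).of_nonneg_of_le
    (fun _ => norm_nonneg _) fun n => ?_
  rw [norm_smul, norm_smul]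
  gcongr
  rw [norm_inv, norm_inv, Complex.norm_natCast, Complex.norm_natCast]
  gcongr
  omega

theorem isBigO_exp_sub_sum [CompleteSpace R] (hx : x =O[l] t) (ht : t =O[l] fun _ => (1 : ℝ))
    {m : ℕ} (hm : m ≠ 0) :
    (fun i => NormedSpace.exp (x i) - ∑ n ∈ range m, ((n ! : ℂ))⁻¹ • x i ^ n) =O[l]
      fun i => t i ^ m :=
  isBigO_sub_sum_range (fun n => by simp) (fun i => NormedSpace.exp_series_hasSum_exp' (x i))
    hx ht hm

theorem isBigO_exp [CompleteSpace R] (hx : x =O[l] fun _ => (1 : ℝ)) :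
    (fun i => NormedSpace.exp (x i)) =O[l] fun _ => (1 : ℝ) := by
  have h := isBigO_exp_sub_sum hx (isBigO_refl _ l) one_ne_zero
  have h' := h.add (f₂ := fun _ => (1 : R))
    (by simpa using isBigO_const_const (1 : R) (one_ne_zero' ℝ) l)
  simpa using h'

/-- The first-order residual of the corrected splitting, as a function of `ad`. -/
theorem isBigO_firstOrder [CompleteSpace R] (k : ℕ) (hx : x =O[l] t)
    (ht : t =O[l] fun _ => (1 : ℝ)) :
    (fun i => phi (x i) - NormedSpace.exp ((1 / 2 : ℂ) • x i) -
      (1 - NormedSpace.exp (x i)) * Polynomial.aeval (x i) (correctorPoly k)) =O[l]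
      fun i => t i ^ (2 * k + 2) := by
  have hm : 2 * k + 2 ≠ 0 := by omega
  have h₁ : (fun i => phi (x i) -
      Polynomial.aeval (x i) (PowerSeries.trunc (2 * k + 2) phiSeries)) =O[l]
      fun i => t i ^ (2 * k + 2) := by
    simp only [aeval_trunc, phiSeries, PowerSeries.coeff_mk]
    exact isBigO_sub_sum_range norm_inv_factorial_succ_le
      (fun i => (summable_norm_phi (x i)).of_norm.hasSum) hx ht hm
  have h₂ : (fun i => NormedSpace.exp ((1 / 2 : ℂ) • x i) - Polynomial.aeval (x i)
      (PowerSeries.trunc (2 * k + 2) (PowerSeries.rescale (1 / 2 : ℂ) (PowerSeries.exp ℂ)))) =O[l]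
      fun i => t i ^ (2 * k + 2) := by
    simp only [aeval_trunc]
    refine isBigO_sub_sum_range (fun n => ?_) (fun i => ?_) hx ht hm
    · simp only [PowerSeries.coeff_rescale, PowerSeries.coeff_exp, norm_mul, norm_pow]
      have : ‖(1 / 2 : ℂ)‖ ^ n ≤ 1 := pow_le_one₀ (norm_nonneg _) (by norm_num)
      have h' : ‖algebraMap ℚ ℂ (1 / (n ! : ℚ))‖ = (n ! : ℝ)⁻¹ := by simp
      rw [h']
      exact mul_le_of_le_one_left (by positivity) this
    · convert NormedSpace.exp_series_hasSum_exp' (𝕂 := ℂ) ((1 / 2 : ℂ) • x i) using 2 with n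
      rw [smul_pow, smul_smul, PowerSeries.coeff_rescale, PowerSeries.coeff_exp, mul_comm]
      simp
  have h₃ : (fun i => NormedSpace.exp (x i) - Polynomial.aeval (x i)
      (PowerSeries.trunc (2 * k + 2) (PowerSeries.exp ℂ))) =O[l]
      fun i => t i ^ (2 * k + 2) := by
    simpa only [aeval_trunc, PowerSeries.coeff_exp, one_div, map_inv₀, map_natCast]
      using isBigO_exp_sub_sum hx ht hm
  have h₄ := isBigO_aeval_of_X_pow_dvd (X_pow_dvd_firstOrder_trunc k) hx ht
  have h₅ := h₃.mul (isBigO_aeval (correctorPoly k) (hx.trans ht))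
  simp only [mul_one] at h₅
  refine (((h₁.sub h₂).add h₅).add h₄).congr_left fun i => ?_
  simp only [map_sub, map_mul, map_one]
  noncomm_ring

end EntireSeries

/-! ### Divided differences of powers -/

section SecondOrder

/-- The divided difference `((x + r)^n - r^n) / x` for commuting `x`, `r`. -/
noncomputable def powDiff {R : Type*} [Ring R] (x r : R) (n : ℕ) : R :=
  ∑ j ∈ range n, n.choose (j + 1) • (x ^ j * r ^ (n - 1 - j))

theorem powDiff_succ {R : Type*} [Ring R] {x r : R} (h : Commute x r) (n : ℕ) :
    powDiff x r (n + 1) = powDiff x r n * r + (x + r) ^ n := by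
  -- A vanishing top term puts both sums over `range (n + 1)`, where Pascal's rule applies.
  rw [h.add_pow, powDiff, powDiff, sum_mul, ← add_zero (∑ i ∈ range n, _),
    show (0 : R) = n.choose (n + 1) • (x ^ n * r ^ (n - n)) by simp]
  have : ∀ i ∈ range n, n.choose (i + 1) • (x ^ i * r ^ (n - 1 - i)) * r =
      n.choose (i + 1) • (x ^ i * r ^ (n - i)) := by
    intro i hi
    rw [mem_range] at hi
    rw [smul_mul_assoc, mul_assoc, ← pow_succ, show n - 1 - i + 1 = n - i by omega]
  rw [sum_congr rfl this, ← sum_range_succ (fun i => n.choose (i + 1) • (x ^ i * r ^ (n - i))),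
    ← sum_add_distrib]
  refine sum_congr rfl fun j _ => ?_
  rw [Nat.choose_succ_succ, add_smul, add_comm, Nat.add_sub_cancel, nsmul_eq_mul, nsmul_eq_mul,
    Nat.cast_comm]
  simp [mul_assoc, Nat.cast_comm]

theorem commute_powDiff {R : Type*} [Ring R] {x r : R} (h : Commute x r) (n : ℕ) :
    Commute (powDiff x r n) r :=
  Commute.sum_left _ _ _ fun _ _ =>
    (((h.pow_left _).mul_left ((Commute.refl r).pow_left _))).smul_left _

variable {R : Type*} [NormedRing R] [NormedAlgebra ℂ R] [CompleteSpace R]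

/-- This is the Cauchy product of the two series; the index shifts by one because the divided
difference lowers the degree by one. -/
theorem hasSum_powDiff (x r : R) :
    HasSum (fun n : ℕ => ((n ! : ℂ))⁻¹ • powDiff x r n) (phi x * NormedSpace.exp r) := by
  rw [← hasSum_nat_add_iff' 1]
  have h := hasSum_sum_range_mul_of_summable_norm (summable_norm_phi x)
    (NormedSpace.norm_expSeries_summable' (𝕂 := ℂ) r)
  rw [(NormedSpace.exp_series_hasSum_exp' (𝕂 := ℂ) r).tsum_eq] at h
  have e : (fun n : ℕ => (((n + 1)! : ℂ))⁻¹ • powDiff x r (n + 1)) = fun n : ℕ =>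
      ∑ j ∈ range (n + 1), ((((j + 1)! : ℂ))⁻¹ • x ^ j) * ((((n - j)! : ℂ))⁻¹ • r ^ (n - j)) := by
    funext n
    rw [powDiff, smul_sum]
    refine sum_congr rfl fun j hj => ?_
    rw [mem_range] at hj
    rw [smul_mul_smul_comm, ← Nat.cast_smul_eq_nsmul ℂ, smul_smul, Nat.add_sub_cancel]
    congr 1
    rw [Nat.cast_choose ℂ (show j + 1 ≤ n + 1 by omega), show n + 1 - (j + 1) = n - j by omega]
    have h₁ : ((n + 1)! : ℂ) ≠ 0 := by exact_mod_cast Nat.factorial_ne_zero _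
    have h₂ : ((j + 1)! : ℂ) ≠ 0 := by exact_mod_cast Nat.factorial_ne_zero _
    have h₃ : ((n - j)! : ℂ) ≠ 0 := by exact_mod_cast Nat.factorial_ne_zero _
    field_simp
  rw [e, sum_range_one, powDiff, range_zero, sum_empty, smul_zero, sub_zero]
  exact h

end SecondOrder

/-! ### Left multiplication, right multiplication and the commutator -/

section Operators

variable {𝔸 : Type*} [NormedRing 𝔸] [NormedAlgebra ℂ 𝔸]

/-- Left multiplication by `X` as a bounded operator. -/
noncomputable def lmul (X : 𝔸) : 𝔸 →L[ℂ] 𝔸 := ContinuousLinearMap.mul ℂ 𝔸 X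

/-- Right multiplication by `X` as a bounded operator. -/
noncomputable def rmul (X : 𝔸) : 𝔸 →L[ℂ] 𝔸 := (ContinuousLinearMap.mul ℂ 𝔸).flip X

/-- The commutator map `Y ↦ X Y - Y X` as a bounded operator. -/
noncomputable def adCLM (X : 𝔸) : 𝔸 →L[ℂ] 𝔸 := lmul X - rmul X

@[simp] theorem lmul_apply (X Y : 𝔸) : lmul X Y = X * Y := rfl

@[simp] theorem rmul_apply (X Y : 𝔸) : rmul X Y = Y * X := rfl

@[simp] theorem adCLM_apply (X Y : 𝔸) : adCLM X Y = ad X Y := rfl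

theorem norm_lmul_le (X : 𝔸) : ‖lmul X‖ ≤ ‖X‖ := ContinuousLinearMap.opNorm_mul_apply_le ℂ 𝔸 X

theorem norm_rmul_le (X : 𝔸) : ‖rmul X‖ ≤ ‖X‖ :=
  ContinuousLinearMap.opNorm_le_bound _ (norm_nonneg X) fun Y => by
    rw [rmul_apply, mul_comm ‖X‖]
    exact norm_mul_le _ _

theorem lmul_smul (c : ℂ) (X : 𝔸) : lmul (c • X) = c • lmul X := by ext; simp

theorem rmul_smul (c : ℂ) (X : 𝔸) : rmul (c • X) = c • rmul X := by ext; simp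

theorem lmul_pow_apply (X Y : 𝔸) (n : ℕ) : (lmul X ^ n) Y = X ^ n * Y := by
  induction n with
  | zero => simp
  | succ n ih => rw [pow_succ', mul_apply_eq_comp, ih, lmul_apply, pow_succ', mul_assoc]

theorem rmul_pow_apply (X Y : 𝔸) (n : ℕ) : (rmul X ^ n) Y = Y * X ^ n := by
  induction n with
  | zero => simp
  | succ n ih => rw [pow_succ', mul_apply_eq_comp, ih, rmul_apply, pow_succ, mul_assoc]

theorem adCLM_pow_apply (X Y : 𝔸) (n : ℕ) : (adCLM X ^ n) Y = (ad X)^[n] Y := by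
  induction n with
  | zero => simp
  | succ n ih =>
    rw [pow_succ', mul_apply_eq_comp, ih, adCLM_apply, Function.iterate_succ_apply']

theorem commute_lmul_rmul (X Z : 𝔸) : Commute (lmul X) (rmul Z) := by
  ext Y
  simp [mul_assoc]

theorem commute_adCLM_rmul (X : 𝔸) : Commute (adCLM X) (rmul X) :=
  (commute_lmul_rmul X X).sub_left (Commute.refl _)

theorem commute_aeval {R : Type*} [Ring R] [Algebra ℂ R] {x r : R} (h : Commute x r)
    (p : Polynomial ℂ) : Commute (Polynomial.aeval x p) r := by
  rw [Polynomial.aeval_eq_sum_range]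
  exact Commute.sum_left _ _ _ fun n _ => (h.pow_left n).smul_left _

theorem commute_smul_left {R : Type*} [Ring R] [Algebra ℂ R] {x r : R} (h : Commute x r)
    (c : ℂ) : Commute (c • x) r := h.smul_left c

variable [CompleteSpace 𝔸]

theorem exp_lmul_apply (X Y : 𝔸) : NormedSpace.exp (lmul X) Y = NormedSpace.exp X * Y := by
  have h₁ := (ContinuousLinearMap.apply ℂ 𝔸 Y).hasSum
    (NormedSpace.exp_series_hasSum_exp' (𝕂 := ℂ) (lmul X))
  have h₂ := (rmul Y).hasSum (NormedSpace.exp_series_hasSum_exp' (𝕂 := ℂ) X)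
  refine h₁.unique (h₂.congr_fun fun n => ?_)
  rw [map_smul, map_smul, ContinuousLinearMap.apply_apply, lmul_pow_apply]
  rfl

theorem exp_rmul_apply (X Y : 𝔸) : NormedSpace.exp (rmul X) Y = Y * NormedSpace.exp X := by
  have h₁ := (ContinuousLinearMap.apply ℂ 𝔸 Y).hasSum
    (NormedSpace.exp_series_hasSum_exp' (𝕂 := ℂ) (rmul X))
  have h₂ := (lmul Y).hasSum (NormedSpace.exp_series_hasSum_exp' (𝕂 := ℂ) X)
  refine h₁.unique (h₂.congr_fun fun n => ?_)
  rw [map_smul, map_smul, ContinuousLinearMap.apply_apply, rmul_pow_apply]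
  rfl

theorem exp_add_of_commute' {R : Type*} [NormedRing R] [NormedAlgebra ℂ R] [CompleteSpace R]
    {x y : R} (h : Commute x y) :
    NormedSpace.exp (x + y) = NormedSpace.exp x * NormedSpace.exp y :=
  NormedSpace.exp_add_of_commute_of_mem_ball (𝕂 := ℂ) h
    ((NormedSpace.expSeries_radius_eq_top ℂ R).symm ▸ edist_lt_top _ _)
    ((NormedSpace.expSeries_radius_eq_top ℂ R).symm ▸ edist_lt_top _ _)

theorem exp_half_mul_exp_half (X : 𝔸) :
    NormedSpace.exp ((1 / 2 : ℂ) • X) * NormedSpace.exp ((1 / 2 : ℂ) • X) = NormedSpace.exp X := by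
  rw [← exp_add_of_commute' (Commute.refl _), ← add_smul]
  norm_num

/-- With L = ad + R and all three commuting, e^L = e^{ad}e^R and e^{L/2}e^{R/2} = e^{ad/2}e^R, so
e^R factors out of every term. -/
theorem firstOrder_eq (X Y : 𝔸) (p : Polynomial ℂ) :
    (phi (adCLM X) * NormedSpace.exp (rmul X)) Y -
        NormedSpace.exp ((1 / 2 : ℂ) • X) * Y * NormedSpace.exp ((1 / 2 : ℂ) • X) -
        (Polynomial.aeval (adCLM X) p Y * NormedSpace.exp X -
          NormedSpace.exp X * Polynomial.aeval (adCLM X) p Y) =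
      ((phi (adCLM X) - NormedSpace.exp ((1 / 2 : ℂ) • adCLM X) -
        (1 - NormedSpace.exp (adCLM X)) * Polynomial.aeval (adCLM X) p) *
          NormedSpace.exp (rmul X)) Y := by
  have hc := commute_adCLM_rmul X
  have hp : Commute (Polynomial.aeval (adCLM X) p) (NormedSpace.exp (rmul X)) :=
    (commute_aeval hc p).exp_right
  have h₁ : NormedSpace.exp (lmul X) = NormedSpace.exp (adCLM X) * NormedSpace.exp (rmul X) := by
    rw [← exp_add_of_commute' hc, adCLM, sub_add_cancel]
  have h₂ : NormedSpace.exp (lmul ((1 / 2 : ℂ) • X)) * NormedSpace.exp (rmul ((1 / 2 : ℂ) • X)) =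
      NormedSpace.exp ((1 / 2 : ℂ) • adCLM X) * NormedSpace.exp (rmul X) := by
    rw [← exp_add_of_commute' (commute_lmul_rmul _ _),
      ← exp_add_of_commute' (commute_smul_left hc _), lmul_smul, rmul_smul, adCLM]
    congr 1
    module
  rw [mul_assoc _ Y, ← exp_rmul_apply ((1 / 2 : ℂ) • X) Y, ← exp_lmul_apply ((1 / 2 : ℂ) • X),
    ← exp_rmul_apply X, ← exp_lmul_apply X]
  simp only [← mul_apply_eq_comp]
  rw [h₂, h₁, ← hp.eq, mul_assoc, ← hp.eq]
  rfl

end Operators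

/-! ### Expansion of e^{X+Y} in powers of Y -/

section Expansion

variable {𝔸 : Type*} [NormedRing 𝔸] [NormedAlgebra ℂ 𝔸]

/-- The part of `(X + Y)^n` that is linear in `Y`. -/
noncomputable def linPart (X Y : 𝔸) (n : ℕ) : 𝔸 := powDiff (adCLM X) (rmul X) n Y

theorem linPart_zero (X Y : 𝔸) : linPart X Y 0 = 0 := by simp [linPart, powDiff]

/-- As ad_X + R_X is left multiplication, the divided difference obeys the recursion of ∑ X^i Y
X^{n-1-i}. -/
theorem linPart_succ (X Y : 𝔸) (n : ℕ) :
    linPart X Y (n + 1) = linPart X Y n * X + X ^ n * Y := by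
  have hc := commute_adCLM_rmul X
  rw [linPart, powDiff_succ hc, (commute_powDiff hc n).eq, adCLM, sub_add_cancel,
    _root_.add_apply, lmul_pow_apply]
  rfl

theorem norm_linPart_le {X Y : 𝔸} {ρ a : ℝ} (ha : 0 ≤ a) (hX : ‖X‖ ≤ ρ) (hY : ‖Y‖ ≤ ρ * a) (n : ℕ) :
    ‖linPart X Y n‖ ≤ (2 * ρ) ^ n * a := by
  have hρ : 0 ≤ ρ := (norm_nonneg X).trans hX
  -- The product is bounded as a whole because `X ^ 0` need not have norm at most 1.
  have hpow : ∀ n, ‖X ^ n * Y‖ ≤ ρ ^ n * (ρ * a) := fun n => by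
    induction n with
    | zero => simpa using hY
    | succ n ih =>
      rw [pow_succ', mul_assoc]
      calc _ ≤ ‖X‖ * ‖X ^ n * Y‖ := norm_mul_le _ _
        _ ≤ ρ * (ρ ^ n * (ρ * a)) := by gcongr
        _ = _ := by ring
  induction n with
  | zero => simpa [linPart_zero] using ha
  | succ n ih =>
    have h : ρ ^ n ≤ (2 * ρ) ^ n := by gcongr; linarith
    rw [linPart_succ]
    calc _ ≤ ‖linPart X Y n‖ * ‖X‖ + ‖X ^ n * Y‖ :=
          (norm_add_le _ _).trans (add_le_add_left (norm_mul_le _ _) _)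
      _ ≤ ((2 * ρ) ^ n * a) * ρ + (2 * ρ) ^ n * (ρ * a) := by
          gcongr
          exact (hpow n).trans (by gcongr)
      _ = _ := by ring

/-- The part of `(X + Y)^n` that is at least quadratic in `Y`. -/
noncomputable def quadPart (X Y : 𝔸) (n : ℕ) : 𝔸 := (X + Y) ^ n - X ^ n - linPart X Y n

theorem quadPart_zero (X Y : 𝔸) : quadPart X Y 0 = 0 := by simp [quadPart, linPart_zero]

theorem quadPart_succ (X Y : 𝔸) (n : ℕ) :
    quadPart X Y (n + 1) = quadPart X Y n * (X + Y) + linPart X Y n * Y := by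
  rw [quadPart, quadPart, linPart_succ, pow_succ, pow_succ]
  noncomm_ring

theorem norm_quadPart_le {X Y : 𝔸} {ρ a : ℝ} (ha : 0 ≤ a) (ha1 : a ≤ 1) (hX : ‖X‖ ≤ ρ)
    (hY : ‖Y‖ ≤ ρ * a) (n : ℕ) : ‖quadPart X Y n‖ ≤ (4 * ρ) ^ n * a ^ 2 := by
  have hρ : 0 ≤ ρ := (norm_nonneg X).trans hX
  induction n with
  | zero => simp [quadPart_zero]; positivity
  | succ n ih =>
    have h₁ : ‖X + Y‖ ≤ 2 * ρ := (norm_add_le _ _).trans (by nlinarith)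
    have h₂ := norm_linPart_le ha hX hY n
    have h₃ : (2 * ρ) ^ n ≤ (4 * ρ) ^ n := by gcongr; norm_num
    rw [quadPart_succ]
    calc _ ≤ ‖quadPart X Y n‖ * ‖X + Y‖ + ‖linPart X Y n‖ * ‖Y‖ :=
          (norm_add_le _ _).trans (add_le_add (norm_mul_le _ _) (norm_mul_le _ _))
      _ ≤ ((4 * ρ) ^ n * a ^ 2) * (2 * ρ) + ((4 * ρ) ^ n * a) * (ρ * a) := by
          gcongr
          exact h₂.trans (by gcongr)
      _ = (4 * ρ) ^ n * a ^ 2 * (3 * ρ) := by ring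
      _ ≤ (4 * ρ) ^ n * a ^ 2 * (4 * ρ) := by gcongr; norm_num
      _ = (4 * ρ) ^ (n + 1) * a ^ 2 := by ring

variable [CompleteSpace 𝔸]

theorem hasSum_quadPart (X Y : 𝔸) :
    HasSum (fun n : ℕ => ((n ! : ℂ))⁻¹ • quadPart X Y n)
      (NormedSpace.exp (X + Y) - NormedSpace.exp X -
        (phi (adCLM X) * NormedSpace.exp (rmul X)) Y) := by
  have h₁ := NormedSpace.exp_series_hasSum_exp' (𝕂 := ℂ) (X + Y)
  have h₂ := NormedSpace.exp_series_hasSum_exp' (𝕂 := ℂ) X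
  have h₃ := (ContinuousLinearMap.apply ℂ 𝔸 Y).hasSum (hasSum_powDiff (adCLM X) (rmul X))
  refine ((h₁.sub h₂).sub h₃).congr_fun fun n => ?_
  simp [quadPart, linPart, smul_sub]

/-- The term Y²/2 is the whole quadratic part up to degree 2. Removing it starts the series at
degree 3, which yields the factor ρ³. -/
theorem norm_exp_add_sub_le {X Y : 𝔸} {ρ a : ℝ} (ha : 0 ≤ a) (ha1 : a ≤ 1) (hX : ‖X‖ ≤ ρ)
    (hY : ‖Y‖ ≤ ρ * a) :
    ‖NormedSpace.exp (X + Y) - NormedSpace.exp X -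
        (phi (adCLM X) * NormedSpace.exp (rmul X)) Y - (1 / 2 : ℂ) • (Y * Y)‖ ≤
      (4 * ρ) ^ 3 * a ^ 2 * Real.exp (4 * ρ) := by
  have hρ : 0 ≤ ρ := (norm_nonneg X).trans hX
  have h₁ := (hasSum_nat_add_iff' 3).mpr (hasSum_quadPart X Y)
  have e : ∑ n ∈ range 3, ((n ! : ℂ))⁻¹ • quadPart X Y n = (1 / 2 : ℂ) • (Y * Y) := by
    simp [sum_range_succ, quadPart_succ, quadPart_zero, linPart_succ, linPart_zero]
  rw [e] at h₁
  have h₂ : HasSum (fun n : ℕ => (4 * ρ) ^ 3 * a ^ 2 * ((4 * ρ) ^ n / n !))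
      ((4 * ρ) ^ 3 * a ^ 2 * Real.exp (4 * ρ)) := by
    rw [Real.exp_eq_exp_ℝ]
    exact (NormedSpace.expSeries_div_hasSum_exp (4 * ρ)).mul_left _
  refine h₁.norm_le_of_bounded h₂ fun n => ?_
  calc ‖(((n + 3)! : ℂ))⁻¹ • quadPart X Y (n + 3)‖
      ≤ ‖(((n + 3)! : ℂ))⁻¹‖ * ‖quadPart X Y (n + 3)‖ := norm_smul_le _ _
    _ ≤ (n ! : ℝ)⁻¹ * ((4 * ρ) ^ (n + 3) * a ^ 2) := by
      refine mul_le_mul ?_ (norm_quadPart_le ha ha1 hX hY _) (norm_nonneg _) (by positivity)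
      rw [norm_inv, Complex.norm_natCast]
      gcongr
      omega
    _ = (4 * ρ) ^ 3 * a ^ 2 * ((4 * ρ) ^ n / n !) := by rw [pow_add]; ring

end Expansion

/-! ### Expansion of the corrected product formula -/

section Remainder

variable {𝔸 : Type*} [NormedRing 𝔸] [NormedAlgebra ℂ 𝔸] {ι : Type*} {l : Filter ι}

theorem isBigO_clm_apply {T : ι → 𝔸 →L[ℂ] 𝔸} {Y : ι → 𝔸} {g h : ι → ℝ} (hT : T =O[l] g)
    (hY : Y =O[l] h) : (fun i => T i (Y i)) =O[l] fun i => g i * h i := by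
  refine IsBigO.trans (isBigO_of_le l fun i => ?_) (hT.norm_left.mul hY.norm_left)
  rw [norm_mul, norm_norm, norm_norm]
  exact (T i).le_opNorm _

theorem isBigO_adCLM {X : ι → 𝔸} {t : ι → ℝ} (hX : X =O[l] t) :
    (fun i => adCLM (X i)) =O[l] t :=
  ((isBigO_of_le l fun i => norm_lmul_le (X i)).trans hX).sub
    ((isBigO_of_le l fun i => norm_rmul_le (X i)).trans hX)

/-- Here p stands for e^{X/2} and W for Y²/2; every summand on the right is then O(a²t³). -/
theorem conj_expansion {R : Type*} [Ring R] (p W Y C eY eC eC' : R) :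
    eC * (p * eY * p) * eC' - (p * p + p * Y * p + W + (C * (p * p) - p * p * C)) =
      ((p - 1) * W * p + W * (p - 1)) + p * (eY - (1 + Y + W)) * p +
        (C * (p * (eY - 1) * p) - p * (eY - 1) * p * C) - C * (p * eY * p) * C +
        (eC - (1 + C)) * (p * eY * p) * eC' + (1 + C) * (p * eY * p) * (eC' - (1 + -C)) := by
  noncomm_ring

theorem isBigO_conj_sub [CompleteSpace 𝔸] {X Y C : ι → 𝔸} {a t : ι → ℝ}
    (hX : X =O[l] t) (hY : Y =O[l] fun i => a i * t i) (hC : C =O[l] fun i => a i * t i ^ 2)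
    (ha : a =O[l] fun _ => (1 : ℝ)) (ht : t =O[l] fun _ => (1 : ℝ)) :
    (fun i => NormedSpace.exp (C i) * (NormedSpace.exp ((1 / 2 : ℂ) • X i) *
        NormedSpace.exp (Y i) * NormedSpace.exp ((1 / 2 : ℂ) • X i)) * NormedSpace.exp (-C i) -
      (NormedSpace.exp (X i) +
        NormedSpace.exp ((1 / 2 : ℂ) • X i) * Y i * NormedSpace.exp ((1 / 2 : ℂ) • X i) +
        (1 / 2 : ℂ) • (Y i * Y i) +
        (C i * NormedSpace.exp (X i) - NormedSpace.exp (X i) * C i))) =O[l]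
      fun i => a i ^ 2 * t i ^ 3 := by
  have hone : (fun _ => (1 : 𝔸)) =O[l] fun _ => (1 : ℝ) :=
    isBigO_const_const (1 : 𝔸) (one_ne_zero' ℝ) l
  have hat : (fun i => a i * t i) =O[l] fun _ => (1 : ℝ) := by simpa using ha.mul ht
  have hat2 : (fun i => a i * t i ^ 2) =O[l] fun _ => (1 : ℝ) := by simpa using ha.mul (ht.pow 2)
  have hX2 : (fun i => (1 / 2 : ℂ) • X i) =O[l] t := hX.const_smul_left (1 / 2 : ℂ)
  have hW : (fun i => (1 / 2 : ℂ) • (Y i * Y i)) =O[l] fun i => a i ^ 2 * t i ^ 2 :=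
    ((hY.mul hY).const_smul_left (1 / 2 : ℂ)).congr_right fun i => by ring
  have hC' : (fun i => -C i) =O[l] fun i => a i * t i ^ 2 := hC.neg_left
  have hp := isBigO_exp (hX2.trans ht)
  have hp1 : (fun i => NormedSpace.exp ((1 / 2 : ℂ) • X i) - 1) =O[l] t := by
    simpa using isBigO_exp_sub_sum hX2 ht one_ne_zero
  have heY := isBigO_exp (hY.trans hat)
  have heY1 : (fun i => NormedSpace.exp (Y i) - 1) =O[l] fun i => a i * t i := by
    simpa using isBigO_exp_sub_sum hY hat one_ne_zero
  have heY3 : (fun i => NormedSpace.exp (Y i) - (1 + Y i + (1 / 2 : ℂ) • (Y i * Y i))) =O[l]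
      fun i => (a i * t i) ^ 3 := by
    simpa [sum_range_succ, pow_two] using isBigO_exp_sub_sum hY hat three_ne_zero
  have heC' := isBigO_exp (hC'.trans hat2)
  have heC2 : (fun i => NormedSpace.exp (C i) - (1 + C i)) =O[l] fun i => (a i * t i ^ 2) ^ 2 := by
    simpa [sum_range_succ] using isBigO_exp_sub_sum hC hat2 two_ne_zero
  have heC2' : (fun i => NormedSpace.exp (-C i) - (1 + -C i)) =O[l]
      fun i => (a i * t i ^ 2) ^ 2 := by
    simpa [sum_range_succ] using isBigO_exp_sub_sum hC' hat2 two_ne_zero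
  have hS : (fun i => NormedSpace.exp ((1 / 2 : ℂ) • X i) * NormedSpace.exp (Y i) *
      NormedSpace.exp ((1 / 2 : ℂ) • X i)) =O[l] fun _ => (1 : ℝ) := by
    simpa using (hp.mul heY).mul hp
  have hS1 : (fun i => NormedSpace.exp ((1 / 2 : ℂ) • X i) * (NormedSpace.exp (Y i) - 1) *
      NormedSpace.exp ((1 / 2 : ℂ) • X i)) =O[l] fun i => a i * t i := by
    simpa using (hp.mul heY1).mul hp
  have hm : (fun i => a i ^ 2 * t i ^ 4) =O[l] fun i => a i ^ 2 * t i ^ 3 :=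
    ((isBigO_refl (fun i => a i ^ 2 * t i ^ 3) l).mul ht).congr (fun i => by ring)
      fun i => by ring
  have hm' : (fun i => a i ^ 3 * t i ^ 3) =O[l] fun i => a i ^ 2 * t i ^ 3 :=
    ((isBigO_refl (fun i => a i ^ 2 * t i ^ 3) l).mul ha).congr (fun i => by ring)
      fun i => by ring
  have t₁ := (((hp1.mul hW).mul hp).congr_right (g₂ := fun i => a i ^ 2 * t i ^ 3)
    fun i => by ring).add ((hW.mul hp1).congr_right (g₂ := fun i => a i ^ 2 * t i ^ 3)
    fun i => by ring)
  have t₂ := ((hp.mul heY3).mul hp).trans (hm'.congr_left fun i => by ring)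
  have t₃ := ((hC.mul hS1).congr_right (g₂ := fun i => a i ^ 2 * t i ^ 3) fun i => by ring).sub
    ((hS1.mul hC).congr_right (g₂ := fun i => a i ^ 2 * t i ^ 3) fun i => by ring)
  have t₄ := ((hC.mul hS).mul hC).trans (hm.congr_left fun i => by ring)
  have t₅ := ((heC2.mul hS).mul heC').trans (hm.congr_left fun i => by ring)
  have t₆ := (((hone.add (hC.trans hat2)).mul hS).mul heC2').trans
    (hm.congr_left fun i => by ring)
  refine (((((t₁.add t₂).add t₃).sub t₄).add t₅).add t₆).congr_left fun i => ?_
  rw [← exp_half_mul_exp_half (X i), conj_expansion]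

end Remainder

/-! ### The corrector as a polynomial in ad_X -/

theorem ad_smul_iterate {𝔸 : Type*} [NormedRing 𝔸] [NormedAlgebra ℂ 𝔸] (c : ℂ) (X Y : 𝔸) (n : ℕ) :
    (ad (c • X))^[n] Y = c ^ n • (ad X)^[n] Y := by
  induction n with
  | zero => simp
  | succ n ih =>
    rw [Function.iterate_succ_apply', Function.iterate_succ_apply', ih, ad, ad, smul_mul_smul_comm,
      smul_mul_smul_comm, mul_comm c, ← smul_sub, ← pow_succ]

theorem corrector_eq_aeval {𝔸 : Type*} [NormedRing 𝔸] [NormedAlgebra ℂ 𝔸] (A B : 𝔸) (α : ℝ)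
    (k : ℕ) (z : ℂ) :
    corrector A B α k z =
      Polynomial.aeval (adCLM (z • A)) (correctorPoly k) (((α : ℂ) * z) • B) := by
  rw [corrector, correctorPoly, map_sum, _root_.sum_apply, smul_sum]
  refine sum_congr rfl fun j hj => ?_
  rw [mem_Icc] at hj
  rw [map_mul, Polynomial.aeval_C, map_pow, Polynomial.aeval_X, ← Algebra.smul_def, _root_.smul_apply,
    map_smul, adCLM_pow_apply, ad_smul_iterate, smul_smul, smul_smul, smul_smul]
  congr 1
  rw [show z ^ (2 * j) = z ^ (2 * j - 1) * z by rw [← pow_succ]; congr 1; omega]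
  ring

/-- The missing constant term gives C one power of t more than Y. -/
theorem X_dvd_correctorPoly (k : ℕ) : (Polynomial.X : Polynomial ℂ) ^ 1 ∣ correctorPoly k :=
  dvd_sum fun j hj => (pow_dvd_pow _ (by rw [mem_Icc] at hj; omega)).mul_left _

end CorrectedPF

/-! ### The error bound -/

open CorrectedPF Asymptotics Filter

theorem mainTheorem1 {𝔸 : Type*} [NormedRing 𝔸] [NormedAlgebra ℂ 𝔸] [CompleteSpace 𝔸]
    (k : ℕ) (hk : 1 ≤ k) (M : ℝ) :
    ∃ K : ℝ, ∀ A B : 𝔸, ‖A‖ ≤ M → ‖B‖ ≤ M →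
      ∀ (α : ℝ) (z : ℂ), 0 < α → α ≤ 1 → ‖z‖ < 1 →
        ‖NormedSpace.exp (z • CorrectedPF.hamiltonian A B α) -
            CorrectedPF.correctedS₂ A B α k z‖ ≤
          K * (α ^ 2 * ‖z‖ ^ 3 + α * ‖z‖ ^ (2 * k + 3)) := by
  -- Big-O along `𝓟 s` is a bound with one constant on all of `s`, which is the required uniformity.
  let s : Set (𝔸 × 𝔸 × ℝ × ℂ) :=
    {q | ‖q.1‖ ≤ M ∧ ‖q.2.1‖ ≤ M ∧ 0 < q.2.2.1 ∧ q.2.2.1 ≤ 1 ∧ ‖q.2.2.2‖ < 1}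
  let a : 𝔸 × 𝔸 × ℝ × ℂ → ℝ := fun q => q.2.2.1
  let t : 𝔸 × 𝔸 × ℝ × ℂ → ℝ := fun q => ‖q.2.2.2‖
  let X : 𝔸 × 𝔸 × ℝ × ℂ → 𝔸 := fun q => q.2.2.2 • q.1
  let Y : 𝔸 × 𝔸 × ℝ × ℂ → 𝔸 := fun q => ((q.2.2.1 : ℂ) * q.2.2.2) • q.2.1
  let C : 𝔸 × 𝔸 × ℝ × ℂ → 𝔸 := fun q => Polynomial.aeval (adCLM (X q)) (correctorPoly k) (Y q)
  have nX : ∀ q ∈ s, ‖X q‖ ≤ M * t q := fun q hq => by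
    rw [mul_comm]
    exact (norm_smul_le _ _).trans (mul_le_mul_of_nonneg_left hq.1 (norm_nonneg _))
  have nY : ∀ q ∈ s, ‖Y q‖ ≤ M * t q * a q := fun q hq => by
    refine (norm_smul_le _ _).trans ?_
    rw [norm_mul, Complex.norm_real, Real.norm_of_nonneg hq.2.2.1.le]
    calc _ ≤ a q * t q * M :=
          mul_le_mul_of_nonneg_left hq.2.1 (mul_nonneg hq.2.2.1.le (norm_nonneg _))
      _ = _ := by ring
  have hX : X =O[𝓟 s] t := isBigO_principal.mpr ⟨M, fun q hq => by
    rw [Real.norm_of_nonneg (norm_nonneg _ : 0 ≤ t q)]; exact nX q hq⟩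
  have hY : Y =O[𝓟 s] fun q => a q * t q := isBigO_principal.mpr ⟨M, fun q hq => by
    rw [Real.norm_of_nonneg (mul_nonneg hq.2.2.1.le (norm_nonneg _))]
    exact (nY q hq).trans_eq (by ring)⟩
  have ha : a =O[𝓟 s] fun _ => (1 : ℝ) := isBigO_principal.mpr ⟨1, fun q hq => by
    rw [Real.norm_of_nonneg hq.2.2.1.le]; simpa using hq.2.2.2.1⟩
  have ht : t =O[𝓟 s] fun _ => (1 : ℝ) := isBigO_principal.mpr ⟨1, fun q hq => by
    rw [Real.norm_of_nonneg (norm_nonneg _ : 0 ≤ t q)]; simpa using hq.2.2.2.2.le⟩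
  have hx := isBigO_adCLM hX
  have hC : C =O[𝓟 s] fun q => a q * t q ^ 2 :=
    (isBigO_clm_apply (isBigO_aeval_of_X_pow_dvd (X_dvd_correctorPoly k) hx ht) hY).congr_right
      fun q => by ring
  have h₁ : (fun q => NormedSpace.exp (X q + Y q) - NormedSpace.exp (X q) -
      (phi (adCLM (X q)) * NormedSpace.exp (rmul (X q))) (Y q) - (1 / 2 : ℂ) • (Y q * Y q)) =O[𝓟 s]
      fun q => a q ^ 2 * t q ^ 3 := by
    refine isBigO_principal.mpr ⟨(4 * M) ^ 3 * Real.exp (4 * M), fun q hq => ?_⟩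
    have hM : 0 ≤ M := (norm_nonneg _).trans hq.1
    have ht0 : 0 ≤ t q := norm_nonneg _
    refine (norm_exp_add_sub_le hq.2.2.1.le hq.2.2.2.1 (nX q hq) (nY q hq)).trans ?_
    rw [Real.norm_of_nonneg (by positivity)]
    have h : Real.exp (4 * (M * t q)) ≤ Real.exp (4 * M) := by
      gcongr
      exact mul_le_of_le_one_right hM hq.2.2.2.2.le
    calc _ ≤ (4 * (M * t q)) ^ 3 * a q ^ 2 * Real.exp (4 * M) :=
          mul_le_mul_of_nonneg_left h (by positivity)
      _ = _ := by ring
  have h₂ := isBigO_conj_sub hX hY hC ha ht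
  have hr : (fun q => NormedSpace.exp (rmul (X q))) =O[𝓟 s] fun _ => (1 : ℝ) :=
    isBigO_exp (((isBigO_of_le _ fun q => norm_rmul_le (X q)).trans hX).trans ht)
  have h₃ := (isBigO_clm_apply ((isBigO_firstOrder k hx ht).mul hr) hY).congr_right
    (g₂ := fun q => a q * t q ^ (2 * k + 3)) fun q => by ring
  obtain ⟨c, hc⟩ := isBigO_principal.mp (h₁.sub h₂)
  obtain ⟨d, hd⟩ := isBigO_principal.mp h₃
  refine ⟨max c d, fun A B hA hB α z hα hα1 hz => ?_⟩
  have hq : (A, B, α, z) ∈ s := ⟨hA, hB, hα, hα1, hz⟩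
  have e₁ := hc _ hq
  have e₂ := hd _ hq
  rw [← firstOrder_eq] at e₂
  rw [Real.norm_of_nonneg (by positivity)] at e₁ e₂
  have eH : z • hamiltonian A B α = X (A, B, α, z) + Y (A, B, α, z) := by
    simp only [hamiltonian, smul_add, smul_smul, X, Y, mul_comm]
  have eS : correctedS₂ A B α k z = NormedSpace.exp (C (A, B, α, z)) *
      (NormedSpace.exp ((1 / 2 : ℂ) • X (A, B, α, z)) * NormedSpace.exp (Y (A, B, α, z)) *
        NormedSpace.exp ((1 / 2 : ℂ) • X (A, B, α, z))) * NormedSpace.exp (-C (A, B, α, z)) := by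
    have ez : (z / 2) • A = (1 / 2 : ℂ) • z • A := by rw [smul_smul, div_mul_eq_mul_div, one_mul]
    rw [correctedS₂, S₂, corrector_eq_aeval, ez]
  rw [eH, eS]
  have e₃ := add_le_add (e₁.trans (mul_le_mul_of_nonneg_right (le_max_left c d) (by positivity)))
    (e₂.trans (mul_le_mul_of_nonneg_right (le_max_right c d) (by positivity)))
  rw [← mul_add] at e₃
  -- The error splits into the two expansion remainders and the linear residual.
  refine le_trans (le_of_eq_of_le (congrArg norm ?_) (norm_add_le _ _)) e₃
  abel
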